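/- Let $d\ge 1$ and let $Q=\{q_1,\dots,q_n\}\subset\mathbb{R}^d$ be a finite family of landmarks (repetitions allowed) that is full rank, i.e. some $d+1$ of its points do not lie on a common hyperplane. Let $w_1,\dots,w_n>0$ be weights with $\sum_i w_i=1$ (for instance $w_i=\frac1n$). Every hyperplane $h\subset\mathbb{R}^d$ can be written uniquely as $h=\{x:\sum_{j=1}^d u_jx_j+u_{d+1}=0\}$ with $\sum_{j=1}^d u_j^2=1$ and with the first nonzero entry of $u$ positive; the signed distance of a point $x$ from $h$ is $v_x(h)=\sum_{j=1}^d u_jx_j+u_{d+1}$. Let $\mathcal H$ be the set of all hyperplanes of $\mathbb{R}^d$, and for $h_1,h_2\in\mathcal H$ put $$\mathtt d_Q(h_1,h_2)=\Big(\sum_{i=1}^n w_i\,\big(v_{q_i}(h_1)-v_{q_i}(h_2)\big)^2\Big)^{1/2},$$ which for $w_i=\frac1n$ is $\big\|\frac1{\sqrt n}(v_Q(h_1)-v_Q(h_2))\big\|$, where $v_Q(h)=(v_{q_1}(h),\dots,v_{q_n}(h))$. Let $F$ be the set of all functions $f:Q\to[0,\infty)$ of the form $f(q)=\big(\sum_{j=1}^d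 a_jx_j+a_{d+1}\big)^2$ for $q=(x_1,\dots,x_d)\in Q$, with $a\in\mathbb{R}^{d+1}$. Put $\bar f=\sum_i w_i f(q_i)$, and define the sensitivities and the total sensitivity by $$\sigma(q_i)=\sup_{f\in F,\ \bar f\neq0}\frac{f(q_i)}{\bar f},\qquad \mathfrak S(F)=\sum_{i=1}^n w_i\,\sigma(q_i).$$ A $\sigma$-sensitive sampling of size $N$ consists of $N$ independent random landmarks $\tilde q_1,\dots,\tilde q_N$, each equal to the $i$-th landmark with probability $w_i\sigma(q_i)/\mathfrak S(F)$, together with the weights $W_k=\frac{\mathfrak S(F)}{N\,\sigma(\tilde q_k)}$. Put $$\mathtt d_{\tilde Q,W}(h_1,h_2)=\Big(\sum_{k=1}^N W_k\,\big(v_{\tilde q_k}(h_1)-v_{\tilde q_k}(h_2)\big)^2\Big)^{1/2}.$$ Theorem. There is an absolute constant $C>0$ such that for all $d$, $Q$, $w$ as above, all $\varepsilon,\delta\in(0,1)$ and every integer $$N\ \ge\ C\,\frac{d}{\varepsilon^2}\Big(d\log\max(d,2)+\log\frac1\delta\Big),$$ a $\sigma$-sensitive sampling of size $N$ is a strong $(0,\varepsilon,\delta)$-coreset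 and a strong $(0,\varepsilon,\delta)$-approximation of $Q$ over $\mathcal H$: with probability at least $1-\delta$, simultaneously for all $f\in F$ $$(1-\varepsilon)\bar f\ \le\ \sum_{k=1}^N W_k\,f(\tilde q_k)\ \le\ (1+\varepsilon)\bar f,$$ and for all $h_1,h_2\in\mathcal H$ $$(1-\varepsilon)\,\mathtt d_Q(h_1,h_2)\ \le\ \mathtt d_{\tilde Q,W}(h_1,h_2)\ \le\ (1+\varepsilon)\,\mathtt d_Q(h_1,h_2).$$ -/

import Mathlib

open MeasureTheory

noncomputable section

/-- A hyperplane in `ℝ^d`, given by its unique coefficient vector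
`u = (u₁, …, u_{d+1})`: `normal = (u₁, …, u_d)` is a unit vector, `offset = u_{d+1}`, and the
first nonzero entry of `u` is positive (it is an entry of `normal`, as `normal ≠ 0`). -/
@[ext]
structure Hyperplane (d : ℕ) where
  normal : EuclideanSpace ℝ (Fin d)
  offset : ℝ
  unit_normal : ∑ j, normal j ^ 2 = 1
  first_pos : ∃ j, 0 < normal j ∧ ∀ i, i < j → normal i = 0

namespace Hyperplane

variable {d : ℕ}

/-- The signed distance from `x` to `h`. -/
def signedDist (h : Hyperplane d) (x : EuclideanSpace ℝ (Fin d)) : ℝ :=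
  ∑ j, h.normal j * x j + h.offset

/-- The hyperplane as a subset of `ℝ^d`. -/
def carrier (h : Hyperplane d) : Set (EuclideanSpace ℝ (Fin d)) :=
  {x | ∑ j, h.normal j * x j + h.offset = 0}

lemma signedDist_eq_inner (h : Hyperplane d) (x : EuclideanSpace ℝ (Fin d)) :
    h.signedDist x = inner ℝ h.normal x + h.offset := by
  simp [signedDist, PiLp.inner_apply, mul_comm]

lemma mem_carrier (h : Hyperplane d) (x : EuclideanSpace ℝ (Fin d)) :
    x ∈ h.carrier ↔ inner ℝ h.normal x + h.offset = 0 := by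
  rw [← signedDist_eq_inner]; rfl

lemma inner_normal_self (h : Hyperplane d) : inner ℝ h.normal h.normal = (1 : ℝ) := by
  rw [← h.unit_normal, PiLp.inner_apply]
  exact Finset.sum_congr rfl fun j _ => by simp [sq]

lemma norm_normal (h : Hyperplane d) : ‖h.normal‖ = 1 := by
  have := h.inner_normal_self
  rw [real_inner_self_eq_norm_sq] at this
  nlinarith [norm_nonneg h.normal]

/-- `signedDist` is, up to its sign, the distance to the closest point of the hyperplane. -/
theorem abs_signedDist (h : Hyperplane d) (x : EuclideanSpace ℝ (Fin d)) :
    |h.signedDist x| = Metric.infDist x h.carrier := by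
  have hp : x - h.signedDist x • h.normal ∈ h.carrier := by
    rw [mem_carrier, inner_sub_right, inner_smul_right, inner_normal_self, signedDist_eq_inner]
    ring
  apply le_antisymm
  · refine (Metric.le_infDist ⟨_, hp⟩).2 fun y hy => ?_
    rw [mem_carrier] at hy
    have h1 : h.signedDist x = inner ℝ h.normal (x - y) := by
      rw [signedDist_eq_inner, inner_sub_right]; linarith
    rw [h1, dist_eq_norm]
    simpa [h.norm_normal] using abs_real_inner_le_norm h.normal (x - y)
  · refine (Metric.infDist_le_dist_of_mem hp).trans ?_
    simp [norm_smul, h.norm_normal]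

lemma eq_of_carrier_eq {h k : Hyperplane d} (hk : h.carrier = k.carrier) : h = k := by
  have hp : -h.offset • h.normal ∈ k.carrier := by
    rw [← hk, mem_carrier, inner_smul_right, inner_normal_self]; ring
  have hq : -h.offset • h.normal + (k.normal - inner ℝ h.normal k.normal • h.normal)
      ∈ k.carrier := by
    rw [← hk, mem_carrier, inner_add_right, inner_sub_right, inner_smul_right, inner_smul_right,
      inner_normal_self]
    ring
  rw [mem_carrier] at hp hq
  rw [inner_add_right, inner_sub_right, inner_smul_right (r := inner ℝ h.normal k.normal),
    inner_normal_self, real_inner_comm h.normal k.normal] at hq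
  rw [inner_smul_right] at hp
  set t : ℝ := inner ℝ h.normal k.normal with ht
  have hcomm : inner ℝ k.normal h.normal = t := by rw [ht, real_inner_comm]
  rw [inner_smul_right] at hq
  rw [hcomm] at hp hq
  have ht2 : t * t = 1 := by linarith
  have hn : k.normal = t • h.normal := by
    have : ‖k.normal - t • h.normal‖ ^ 2 = 0 := by
      rw [← real_inner_self_eq_norm_sq, inner_sub_left, inner_sub_right, inner_sub_right,
        inner_smul_right, inner_smul_left, inner_smul_left, inner_smul_right,
        inner_normal_self, inner_normal_self, hcomm, ← ht]
      simp
      linarith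
    have := pow_eq_zero_iff (two_ne_zero) |>.1 this
    exact sub_eq_zero.1 (norm_eq_zero.1 this)
  have hcoord : ∀ j, k.normal j = t * h.normal j := fun j => by rw [hn]; simp
  obtain ⟨i, hi, hi'⟩ := h.first_pos
  obtain ⟨j, hj, hj'⟩ := k.first_pos
  have ht0 : t ≠ 0 := by rintro h0; simp [h0] at ht2
  have hij : i = j := by
    rcases lt_trichotomy i j with hl | hl | hl
    · have := hj' i hl
      rw [hcoord] at this
      rcases mul_eq_zero.1 this with h0 | h0
      · exact absurd h0 ht0
      · exact absurd h0 hi.ne'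
    · exact hl
    · rw [hcoord, hi' j hl] at hj
      simp at hj
  subst hij
  have htpos : 0 < t := by
    rw [hcoord] at hj
    exact pos_of_mul_pos_left hj hi.le
  have ht1 : t = 1 := by nlinarith
  apply Hyperplane.ext
  · rw [hn, ht1, one_smul]
  · rw [ht1] at hp; linarith

/-- Every hyperplane of `ℝ^d`, that is every zero set of a non-constant affine function, is the
carrier of exactly one `Hyperplane d`. -/
theorem existsUnique_carrier_eq (a : EuclideanSpace ℝ (Fin d)) (ha : a ≠ 0) (b : ℝ) :
    ∃! h : Hyperplane d, h.carrier = {x | ∑ j, a j * x j + b = 0} := by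
  have hex : ∃ i, a i ≠ 0 ∧ ∀ j, j < i → a j = 0 := by
    have hne : (Finset.univ.filter fun i => a i ≠ 0).Nonempty := by
      by_contra hcon
      apply ha
      ext i
      by_contra hi
      exact hcon ⟨i, by simpa using hi⟩
    refine ⟨_, (Finset.mem_filter.1 (Finset.min'_mem _ hne)).2, fun j hj => ?_⟩
    by_contra h0
    exact absurd (Finset.min'_le _ j (by simpa using h0)) (not_le.2 hj)
  obtain ⟨i, hi, hi'⟩ := hex
  have hnorm : 0 < ‖a‖ := norm_pos_iff.2 ha
  have hsq : ∑ j, a j ^ 2 = ‖a‖ ^ 2 := by simp [EuclideanSpace.norm_sq_eq]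
  obtain ⟨s, hs2, hsi⟩ : ∃ s : ℝ, s ^ 2 = 1 ∧ 0 < s * a i := by
    rcases lt_or_gt_of_ne hi with h0 | h0
    · exact ⟨-1, by norm_num, by linarith⟩
    · exact ⟨1, by norm_num, by linarith⟩
  have hs0 : s ≠ 0 := by rintro rfl; simp at hs2
  let h : Hyperplane d :=
    { normal := (s / ‖a‖) • a
      offset := (s / ‖a‖) * b
      unit_normal := by
        simp only [PiLp.smul_apply, smul_eq_mul, mul_pow, ← Finset.mul_sum, hsq, div_pow, hs2]
        field_simp
      first_pos := ⟨i, by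
        simp only [PiLp.smul_apply, smul_eq_mul]
        rw [div_mul_eq_mul_div]
        positivity, fun j hj => by simp [hi' j hj]⟩ }
  have hh : h.carrier = {x | ∑ j, a j * x j + b = 0} := by
    ext x
    have : ∑ j, h.normal j * x j + h.offset = (s / ‖a‖) * (∑ j, a j * x j + b) := by
      simp only [h, PiLp.smul_apply, smul_eq_mul, mul_add, Finset.mul_sum, mul_assoc]
    simp only [carrier, Set.mem_ofPred_eq, this, mul_eq_zero, div_eq_zero_iff, hs0, hnorm.ne',
      or_self, false_or]
  exact ⟨h, hh, fun k hk => eq_of_carrier_eq (hk.trans hh.symm)⟩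

end Hyperplane

/-- The landmarks `q 0, …, q (n-1)` (repetitions allowed) are full rank: some `d + 1` of them do
not lie on a common hyperplane. -/
def FullRank {d n : ℕ} (q : Fin n → EuclideanSpace ℝ (Fin d)) : Prop :=
  ∃ s : Fin (d + 1) → Fin n, ∀ h : Hyperplane d, ∃ k, q (s k) ∉ h.carrier

/-- The weighted sketch `(√w₁ · v₁(h), …, √wₙ · vₙ(h))` of a hyperplane, `vᵢ(h)` being the signed
distance from `qᵢ` to `h`. -/
def sketch {d n : ℕ} (w : Fin n → ℝ) (q : Fin n → EuclideanSpace ℝ (Fin d))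
    (h : Hyperplane d) : EuclideanSpace ℝ (Fin n) :=
  WithLp.toLp 2 fun i => √(w i) * h.signedDist (q i)

/-- The distance of two hyperplanes through their weighted sketches. For `w = 1 / n` it is
`‖(1 / √n) • (v_Q h₁ - v_Q h₂)‖`. -/
def sketchDist {d n : ℕ} (w : Fin n → ℝ) (q : Fin n → EuclideanSpace ℝ (Fin d))
    (h₁ h₂ : Hyperplane d) : ℝ :=
  ‖sketch w q h₁ - sketch w q h₂‖

lemma sketchDist_uniform {d n : ℕ} (q : Fin n → EuclideanSpace ℝ (Fin d))
    (h₁ h₂ : Hyperplane d) :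
    sketchDist (fun _ => 1 / (n : ℝ)) q h₁ h₂ =
      ‖(1 / √(n : ℝ)) • (WithLp.toLp 2 fun i => h₁.signedDist (q i) - h₂.signedDist (q i) :
        EuclideanSpace ℝ (Fin n))‖ := by
  unfold sketchDist sketch
  congr 1
  ext i
  simp
  ring

/-- The space `V` of the affine functions `v_a(q) = ∑ aᵢ xᵢ + a_{d+1}`, restricted to the
landmarks. -/
def affineFunctions {d n : ℕ} (q : Fin n → EuclideanSpace ℝ (Fin d)) : Set (Fin n → ℝ) :=
  {v | ∃ (a : EuclideanSpace ℝ (Fin d)) (b : ℝ), ∀ i, v i = ∑ j, a j * q i j + b}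

/-- The family `F` of the squares of the functions in `V`. -/
def squaredAffine {d n : ℕ} (q : Fin n → EuclideanSpace ℝ (Fin d)) : Set (Fin n → ℝ) :=
  {f | ∃ v ∈ affineFunctions q, ∀ i, f i = v i ^ 2}

/-- The integral `f̄ = ∑ wᵢ f(qᵢ)`. -/
def weightedMean {n : ℕ} (w : Fin n → ℝ) (f : Fin n → ℝ) : ℝ := ∑ i, w i * f i

/-- The sensitivity `σ(qᵢ) = sup_{f ∈ F} f(qᵢ) / f̄`. A function with `f̄ = 0` (for positive
weights and nonnegative `f` this is the zero function only) contributes `0`. -/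
def sensitivity {n : ℕ} (w : Fin n → ℝ) (F : Set (Fin n → ℝ)) (i : Fin n) : ℝ :=
  ⨆ f : F, f.1 i / weightedMean w f.1

/-- The total sensitivity `∑ wᵢ σ(qᵢ)`. -/
def totalSensitivity {n : ℕ} (w : Fin n → ℝ) (F : Set (Fin n → ℝ)) : ℝ :=
  ∑ i, w i * sensitivity w F i

/-- The law of one draw of `σ`-sensitive sampling: landmark `i` has probability
`wᵢ σ(qᵢ) / 𝔖(F)`. -/
def sensitivityLaw {n : ℕ} (w : Fin n → ℝ) (F : Set (Fin n → ℝ)) : Measure (Fin n) :=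
  ∑ i, ENNReal.ofReal (w i * sensitivity w F i / totalSensitivity w F) • Measure.dirac i

/-- The law of `N` independent draws. -/
def sensitivitySampling {n : ℕ} (w : Fin n → ℝ) (F : Set (Fin n → ℝ)) (N : ℕ) :
    Measure (Fin N → Fin n) :=
  Measure.pi fun _ => sensitivityLaw w F

/-- The weights `𝔖(F) / (N σ(x_k))` of the sampled landmarks `x_1, …, x_N`. -/
def sampleWeight {n N : ℕ} (w : Fin n → ℝ) (F : Set (Fin n → ℝ)) (x : Fin N → Fin n) :
    Fin N → ℝ :=
  fun k => totalSensitivity w F / (N * sensitivity w F (x k))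

end

/-!
Square roots of the weights turn the affine functions on the landmarks into a subspace of `ℝⁿ`, and
an orthonormal basis of it turns the landmarks into vectors `φ i ∈ ℝᵐ`, `m ≤ d + 1`, such that `F`
consists of the functions `i ↦ ⟪a, φ i⟫²` and the mean of such a function is `‖a‖²`
(`exists_isotropic`). In these coordinates the sensitivity of the `i`-th landmark is `‖φ i‖²` and
the total sensitivity is `m`. The coreset property then says that the random quadratic form
`a ↦ (1 / N) ∑ₖ m ⟪a, φ (x k)⟫² / ‖φ (x k)‖² - ‖a‖²` is at most `ε ‖a‖²` in absolute value.

For a fixed `a` this is a Chernoff bound: the summands are nonnegative, bounded by `m ‖a‖²` and have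
mean `‖a‖²`, so that a relative error `s` has probability at most `2 exp (-N s² / (4 m))`
(`pi_real_abs_sum_sub_le`, `pi_real_frame_error_le`). For all `a` at once it suffices to control the
form on a `1 / 4`-net of the unit ball (`abs_quadraticForm_le_of_cubeGrid`). The term `d log d` of
the sample size leaves room for the plain grid `(1 / (4 m)) ℤ ^ m ∩ [-1, 1] ^ m` with its
`(8 m + 1) ^ m` points as the net (`grid_union_bound_le`).

The squared difference of the signed distances of two hyperplanes is a function in `F`, so the
bounds for `sketchDist` follow on taking square roots.
-/

/-! ### Isotropic coordinates -/

/-- The vector `φ i` lists the `i`-th entries of an orthonormal basis of the space of affine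
functions in `L²(w)`. -/
theorem exists_isotropic {d n : ℕ} (q : Fin n → EuclideanSpace ℝ (Fin d)) {w : Fin n → ℝ}
    (hw : ∀ i, 0 < w i) :
    ∃ (m : ℕ) (φ : Fin n → EuclideanSpace ℝ (Fin m)), m ≤ d + 1 ∧
      (∀ a, ∑ i, w i * (inner ℝ a (φ i)) ^ 2 = ‖a‖ ^ 2) ∧
      squaredAffine q = Set.range fun a i => (inner ℝ a (φ i)) ^ 2 := by
  let T : (EuclideanSpace ℝ (Fin d) × ℝ) →ₗ[ℝ] EuclideanSpace ℝ (Fin n) :=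
    { toFun := fun p => WithLp.toLp 2 fun i => √(w i) * (∑ j, p.1 j * q i j + p.2)
      map_add' := fun p p' => by
        ext i
        simp [add_mul, Finset.sum_add_distrib]
        ring
      map_smul' := fun c p => by
        ext i
        simp only [Prod.smul_fst, Prod.smul_snd, PiLp.smul_apply, smul_eq_mul, mul_assoc,
          ← Finset.mul_sum, RingHom.id_apply]
        ring }
  let B := stdOrthonormalBasis ℝ (LinearMap.range T)
  have hs : ∀ i, 0 < √(w i) := fun i => Real.sqrt_pos.2 (hw i)
  let φ : Fin n → EuclideanSpace ℝ (Fin (Module.finrank ℝ (LinearMap.range T))) :=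
    fun i => WithLp.toLp 2 fun j => (B j : EuclideanSpace ℝ (Fin n)) i / √(w i)
  have key : ∀ a i, ((B.repr.symm a : LinearMap.range T) : EuclideanSpace ℝ (Fin n)) i =
      √(w i) * inner ℝ a (φ i) := by
    intro a i
    rw [← B.sum_repr_symm]
    simp only [φ, PiLp.inner_apply, Submodule.coe_sum, Submodule.coe_smul, WithLp.ofLp_sum,
      Finset.sum_apply, PiLp.smul_apply, smul_eq_mul, Finset.mul_sum, RCLike.inner_apply, conj_trivial]
    refine Finset.sum_congr rfl fun j _ => ?_
    have := (hs i).ne'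
    field_simp
  refine ⟨_, φ, ?_, fun a => ?_, ?_⟩
  · refine (LinearMap.finrank_range_le T).trans ?_
    simp
  · rw [← B.repr.symm.norm_map a, Submodule.coe_norm, EuclideanSpace.norm_sq_eq]
    refine Finset.sum_congr rfl fun i _ => ?_
    rw [key, Real.norm_eq_abs, sq_abs, mul_pow, Real.sq_sqrt (hw i).le]
  · ext f
    constructor
    · rintro ⟨v, ⟨a, b, hv⟩, hf⟩
      refine ⟨B.repr ⟨T (a, b), LinearMap.mem_range_self T _⟩, funext fun i => ?_⟩
      have h := key (B.repr ⟨T (a, b), LinearMap.mem_range_self T _⟩) i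
      rw [LinearIsometryEquiv.symm_apply_apply] at h
      have h' : inner ℝ (B.repr ⟨T (a, b), LinearMap.mem_range_self T _⟩) (φ i) = v i := by
        rw [hv]
        exact (mul_left_cancel₀ (hs i).ne' h).symm
      simp only [h', hf]
    · rintro ⟨a, rfl⟩
      obtain ⟨⟨a', b'⟩, hab⟩ := (B.repr.symm a).2
      refine ⟨fun i => inner ℝ a (φ i), ⟨a', b', fun i => ?_⟩, fun i => rfl⟩
      have h := key a i
      rw [← hab] at h
      exact (mul_left_cancel₀ (hs i).ne' h).symm

/-! ### Sensitivities in isotropic coordinates -/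

section Isotropic

variable {n m : ℕ} {w : Fin n → ℝ} {φ : Fin n → EuclideanSpace ℝ (Fin m)}

/-- The trace of the isotropy identity. -/
theorem sum_mul_norm_sq_of_isotropic
    (hφ : ∀ a, ∑ i, w i * (inner ℝ a (φ i)) ^ 2 = ‖a‖ ^ 2) :
    ∑ i, w i * ‖φ i‖ ^ 2 = m := by
  simp only [EuclideanSpace.norm_sq_eq, Real.norm_eq_abs, sq_abs, Finset.mul_sum]
  rw [Finset.sum_comm]
  have h : ∀ j : Fin m, ∑ i, w i * φ i j ^ 2 = 1 := fun j => by
    simpa [EuclideanSpace.inner_single_left] using hφ (EuclideanSpace.single j 1)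
  simp [h]

theorem sensitivity_of_isotropic (hφ : ∀ a, ∑ i, w i * (inner ℝ a (φ i)) ^ 2 = ‖a‖ ^ 2)
    (i : Fin n) :
    sensitivity w (Set.range fun a i => (inner ℝ a (φ i)) ^ 2) i = ‖φ i‖ ^ 2 := by
  have hle : ∀ f : Set.range fun (a : EuclideanSpace ℝ (Fin m)) i => (inner ℝ a (φ i)) ^ 2,
      f.1 i / weightedMean w f.1 ≤ ‖φ i‖ ^ 2 := by
    rintro ⟨_, a, rfl⟩
    simp only [weightedMean, hφ]
    refine div_le_of_le_mul₀ (sq_nonneg _) (sq_nonneg _) ?_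
    rw [← mul_pow, ← sq_abs]
    refine pow_le_pow_left₀ (abs_nonneg _) ?_ 2
    rw [mul_comm]
    exact abs_real_inner_le_norm _ _
  have : Nonempty (Set.range fun (a : EuclideanSpace ℝ (Fin m)) i => (inner ℝ a (φ i)) ^ 2) :=
    ⟨⟨_, 0, rfl⟩⟩
  refine le_antisymm (ciSup_le hle) ?_
  -- equality in Cauchy–Schwarz: the supremum is attained at `a = φ i`
  refine le_ciSup_of_le ⟨_, Set.forall_mem_range.2 hle⟩ ⟨_, φ i, rfl⟩ ?_
  simp only [weightedMean, hφ, real_inner_self_eq_norm_sq]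
  rcases eq_or_ne (‖φ i‖ ^ 2) 0 with h | h
  · simp [h]
  · rw [sq (‖φ i‖ ^ 2), mul_div_cancel_right₀ _ h]

theorem totalSensitivity_of_isotropic
    (hφ : ∀ a, ∑ i, w i * (inner ℝ a (φ i)) ^ 2 = ‖a‖ ^ 2) :
    totalSensitivity w (Set.range fun a i => (inner ℝ a (φ i)) ^ 2) = m := by
  simp only [totalSensitivity, sensitivity_of_isotropic hφ, sum_mul_norm_sq_of_isotropic hφ]

end Isotropic

/-! ### Chernoff bounds for independent draws -/

theorem integral_sum_dirac {n : ℕ} {p : Fin n → ℝ} (hp : ∀ i, 0 ≤ p i) (f : Fin n → ℝ) :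
    ∫ i, f i ∂(∑ i, ENNReal.ofReal (p i) • Measure.dirac i) = ∑ i, p i * f i := by
  rw [integral_finsetSum_measure fun i _ => ?_]
  · simp [integral_smul_measure, ENNReal.toReal_ofReal, hp]
  · exact (integrable_dirac (by simp)).smul_measure ENNReal.ofReal_ne_top

theorem isProbabilityMeasure_sum_dirac {n : ℕ} {p : Fin n → ℝ} (hp : ∀ i, 0 ≤ p i)
    (h1 : ∑ i, p i = 1) :
    IsProbabilityMeasure (∑ i, ENNReal.ofReal (p i) • Measure.dirac i : Measure (Fin n)) := by
  constructor
  simp [← ENNReal.ofReal_sum_of_nonneg fun i _ => hp i, h1]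

/-- The boundedness enters through `E X² ≤ b E X`: the second order term of the exponential moment
is `τ² b μ` rather than `τ² b²`, which saves a factor `b / μ` in the tail bounds below. -/
theorem integral_exp_mul_le {n : ℕ} {P : Measure (Fin n)} [IsProbabilityMeasure P]
    {X : Fin n → ℝ} {b μ τ : ℝ} (h0 : ∀ i, 0 ≤ X i) (hb : ∀ i, X i ≤ b) (hμ : ∫ i, X i ∂P = μ)
    (hτ : |τ| * b ≤ 1) :
    ∫ i, Real.exp (τ * X i) ∂P ≤ Real.exp (τ * μ + τ ^ 2 * b * μ) := by
  have hpt : ∀ i, Real.exp (τ * X i) ≤ 1 + (τ + τ ^ 2 * b) * X i := fun i => by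
    have h1 : |τ * X i| ≤ 1 := by
      rw [abs_mul, abs_of_nonneg (h0 i)]
      exact (mul_le_mul_of_nonneg_left (hb i) (abs_nonneg _)).trans hτ
    have h2 := (abs_le.1 (Real.abs_exp_sub_one_sub_id_le h1)).2
    have h3 : X i * X i ≤ b * X i := mul_le_mul_of_nonneg_right (hb i) (h0 i)
    nlinarith [mul_le_mul_of_nonneg_left h3 (sq_nonneg τ)]
  calc ∫ i, Real.exp (τ * X i) ∂P ≤ ∫ i, (1 + (τ + τ ^ 2 * b) * X i) ∂P :=
        integral_mono (.of_finite) (.of_finite) hpt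
    _ = (τ * μ + τ ^ 2 * b * μ) + 1 := by
        rw [integral_add (.of_finite) (.of_finite), integral_const_mul, hμ]
        simp
        ring
    _ ≤ _ := Real.add_one_le_exp _

/-- Chernoff bound for the sum of `N` independent copies of `X`; the sign of `τ` selects the upper
or the lower tail. -/
theorem pi_real_le_exp {n N : ℕ} {P : Measure (Fin n)} [IsProbabilityMeasure P]
    {X : Fin n → ℝ} {b μ τ c : ℝ} (h0 : ∀ i, 0 ≤ X i) (hb : ∀ i, X i ≤ b) (hμ : ∫ i, X i ∂P = μ)
    (hτ : |τ| * b ≤ 1) :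
    (Measure.pi fun _ : Fin N => P).real {x | N * c ≤ τ * ∑ k, X (x k)} ≤
      Real.exp (N * (τ * μ + τ ^ 2 * b * μ - c)) := by
  have hint : ∫ x, Real.exp (τ * ∑ k, X (x k)) ∂(Measure.pi fun _ : Fin N => P) ≤
      Real.exp (N * (τ * μ + τ ^ 2 * b * μ)) := by
    simp only [Finset.mul_sum, Real.exp_sum]
    rw [integral_fintype_prod_eq_pow fun i => Real.exp (τ * X i), Fintype.card_fin,
      Real.exp_nat_mul]
    exact pow_le_pow_left₀ (integral_nonneg fun _ => (Real.exp_pos _).le)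
      (integral_exp_mul_le h0 hb hμ hτ) N
  have hmarkov := mul_meas_ge_le_integral_of_nonneg
    (μ := Measure.pi fun _ : Fin N => P) (f := fun x => Real.exp (τ * ∑ k, X (x k)))
    (Filter.Eventually.of_forall fun _ => (Real.exp_pos _).le) (.of_finite) (Real.exp (N * c))
  simp only [Real.exp_le_exp] at hmarkov
  rw [mul_sub, Real.exp_sub, le_div_iff₀ (Real.exp_pos _), mul_comm]
  exact hmarkov.trans hint

/-- Two-sided Chernoff bound for relative errors, with `τ = ± s / (2 b)`. -/
theorem pi_real_abs_sum_sub_le {n N : ℕ} {P : Measure (Fin n)} [IsProbabilityMeasure P]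
    {X : Fin n → ℝ} {b μ s : ℝ} (h0 : ∀ i, 0 ≤ X i) (hb : ∀ i, X i ≤ b) (hμ : ∫ i, X i ∂P = μ)
    (hbpos : 0 < b) (hs : 0 < s) (hs1 : s ≤ 1) :
    (Measure.pi fun _ : Fin N => P).real {x | N * (s * μ) < |∑ k, X (x k) - N * μ|} ≤
      2 * Real.exp (-(N * (s ^ 2 * μ / (4 * b)))) := by
  have hτpos : 0 < s / (2 * b) := by positivity
  have hτ : |s / (2 * b)| * b ≤ 1 := by
    rw [abs_of_pos hτpos, show s / (2 * b) * b = s / 2 by field_simp]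
    linarith
  have hup := pi_real_le_exp (N := N) (c := s / (2 * b) * (μ + s * μ)) h0 hb hμ hτ
  have hlo := pi_real_le_exp (N := N) (τ := -(s / (2 * b)))
    (c := -(s / (2 * b)) * (μ - s * μ)) h0 hb hμ (by rwa [abs_neg])
  have e1 : (N : ℝ) * (s / (2 * b) * μ + (s / (2 * b)) ^ 2 * b * μ - s / (2 * b) * (μ + s * μ)) =
      -(N * (s ^ 2 * μ / (4 * b))) := by field_simp; ring
  have e2 : (N : ℝ) * (-(s / (2 * b)) * μ + (-(s / (2 * b))) ^ 2 * b * μ -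
      -(s / (2 * b)) * (μ - s * μ)) = -(N * (s ^ 2 * μ / (4 * b))) := by field_simp; ring
  rw [e1] at hup
  rw [e2] at hlo
  rw [two_mul]
  refine (measureReal_mono ?_).trans ((measureReal_union_le _ _).trans (add_le_add hup hlo))
  intro x hx
  rw [Set.mem_ofPred_eq, lt_abs] at hx
  rcases hx with hx | hx
  · left
    have := mul_le_mul_of_nonneg_left hx.le hτpos.le
    simp only [Set.mem_ofPred_eq]
    linarith
  · right
    have := mul_le_mul_of_nonneg_left hx.le hτpos.le
    simp only [Set.mem_ofPred_eq]
    linarith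

/-! ### Quadratic forms controlled on a grid -/

/-- The grid `(1 / (4 m)) ℤ ^ m ∩ [-1, 1] ^ m`. Its mesh is chosen so that rounding moves a vector
by at most `√m / (4 m) ≤ 1 / 4`. -/
noncomputable def cubeGrid (m : ℕ) : Finset (EuclideanSpace ℝ (Fin m)) :=
  (Fintype.piFinset fun _ : Fin m => Finset.Icc (-(4 * m : ℤ)) (4 * m)).image
    fun k => WithLp.toLp 2 fun j => (k j : ℝ) / (4 * m)

theorem card_cubeGrid_le (m : ℕ) : (cubeGrid m).card ≤ (8 * m + 1) ^ m := by
  refine Finset.card_image_le.trans (le_of_eq ?_)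
  rw [Fintype.card_piFinset, Finset.prod_const, Int.card_Icc, Finset.card_univ, Fintype.card_fin]
  congr 1
  omega

theorem exists_mem_cubeGrid_norm_sub_le {m : ℕ} {x : EuclideanSpace ℝ (Fin m)} (hm : 0 < m)
    (hx : ‖x‖ ≤ 1) : ∃ t ∈ cubeGrid m, ‖x - t‖ ≤ 1 / 4 := by
  have hm' : (0 : ℝ) < m := by exact_mod_cast hm
  have hm1 : (1 : ℝ) ≤ m := by exact_mod_cast hm
  refine ⟨_, Finset.mem_image.2 ⟨fun j => ⌊4 * m * x j⌋, ?_, rfl⟩, ?_⟩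
  · rw [Fintype.mem_piFinset]
    intro j
    have hj : |x j| ≤ 1 := (PiLp.norm_apply_le x j).trans hx
    rw [abs_le] at hj
    rw [Finset.mem_Icc]
    constructor
    · rw [Int.le_floor]
      push_cast
      nlinarith
    · have : ⌊4 * m * x j⌋ ≤ ⌊((4 * m : ℤ) : ℝ)⌋ := by
        refine Int.floor_mono ?_
        push_cast
        nlinarith
      rwa [Int.floor_intCast] at this
  · have hj : ∀ j, (x j - (⌊4 * m * x j⌋ : ℝ) / (4 * m)) ^ 2 ≤ (1 / (4 * m)) ^ 2 := fun j => by
      have h1 := Int.floor_le (4 * m * x j)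
      have h2 := (Int.lt_floor_add_one (4 * m * x j)).le
      have e : x j - (⌊4 * m * x j⌋ : ℝ) / (4 * m) = (4 * m * x j - ⌊4 * m * x j⌋) / (4 * m) := by
        field_simp
      rw [e]
      refine pow_le_pow_left₀ (div_nonneg (by linarith) (by positivity)) ?_ 2
      gcongr
      linarith
    refine (sq_le_sq₀ (norm_nonneg _) (by norm_num)).1 ?_
    rw [EuclideanSpace.norm_sq_eq]
    simp only [PiLp.sub_apply, Real.norm_eq_abs, sq_abs]
    refine (Finset.sum_le_sum fun j _ => hj j).trans ?_
    rw [Finset.sum_const, Finset.card_univ, Fintype.card_fin, nsmul_eq_mul,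
      show (m : ℝ) * (1 / (4 * m)) ^ 2 = 1 / (16 * m) by field_simp; norm_num]
    rw [div_le_iff₀ (by positivity)]
    linarith

/-- If `K` is the maximum of `|Q|` on the unit sphere, attained at `z`, and `t` is a grid point near
`z`, then `|Q z - Q t| ≤ (9 / 16) K`, whence `(7 / 16) K ≤ |Q t| ≤ (25 / 16) s`. -/
theorem abs_quadraticForm_le_of_cubeGrid {m : ℕ} (hm : 0 < m)
    {Q : QuadraticForm ℝ (EuclideanSpace ℝ (Fin m))} (hQ : Continuous Q) {s : ℝ}
    (hs : ∀ t ∈ cubeGrid m, |Q t| ≤ s * ‖t‖ ^ 2) (x : EuclideanSpace ℝ (Fin m)) :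
    |Q x| ≤ 4 * s * ‖x‖ ^ 2 := by
  have : Nonempty (Fin m) := ⟨⟨0, hm⟩⟩
  obtain ⟨z, hz, hmax⟩ := (isCompact_sphere (0 : EuclideanSpace ℝ (Fin m)) 1).exists_isMaxOn
    (NormedSpace.sphere_nonempty.2 zero_le_one) hQ.abs.continuousOn
  have hz1 : ‖z‖ = 1 := by simpa using hz
  have hbound : ∀ y, |Q y| ≤ |Q z| * ‖y‖ ^ 2 := fun y => by
    rcases eq_or_ne y 0 with rfl | hy
    · simp
    have hy' : ‖y‖ ≠ 0 := norm_ne_zero_iff.2 hy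
    have h1 : |Q (‖y‖⁻¹ • y)| ≤ |Q z| := hmax (by simp [norm_smul, hy'])
    have h2 : Q y = ‖y‖ ^ 2 * Q (‖y‖⁻¹ • y) := by
      rw [QuadraticMap.map_smul, smul_eq_mul]
      field_simp
    rw [h2, abs_mul, abs_of_nonneg (sq_nonneg _), mul_comm]
    gcongr
  obtain ⟨t, ht, hzt⟩ := exists_mem_cubeGrid_norm_sub_le hm hz1.le
  have htn : ‖t‖ ≤ 5 / 4 := by
    have := norm_sub_norm_le t z
    rw [norm_sub_rev, hz1] at this
    linarith
  -- polarization of `Q z - Q t`, the form at `(z - t, z + t)`, in the vectors `3 • (z - t)` and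
  -- `3⁻¹ • (z + t)`, whose lengths are balanced
  have hpol : 4 * (Q z - Q t) = Q ((3 : ℝ) • (z - t) + (1 / 3 : ℝ) • (z + t)) -
      Q ((3 : ℝ) • (z - t) - (1 / 3 : ℝ) • (z + t)) := by
    have e1 : (3 : ℝ) • (z - t) + (1 / 3 : ℝ) • (z + t) = (10 / 3 : ℝ) • z + (-8 / 3 : ℝ) • t := by
      module
    have e2 : (3 : ℝ) • (z - t) - (1 / 3 : ℝ) • (z + t) = (8 / 3 : ℝ) • z + (-10 / 3 : ℝ) • t := by
      module
    rw [e1, e2, QuadraticMap.map_add Q, QuadraticMap.map_add Q ((8 / 3 : ℝ) • z)]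
    simp only [QuadraticMap.map_smul, QuadraticMap.polar_smul_left, QuadraticMap.polar_smul_right,
      smul_eq_mul]
    ring
  have hpar := parallelogram_law_with_norm ℝ ((3 : ℝ) • (z - t)) ((1 / 3 : ℝ) • (z + t))
  have hu : ‖(3 : ℝ) • (z - t)‖ ≤ 3 / 4 := by
    rw [norm_smul]
    norm_num
    linarith
  have hv : ‖(1 / 3 : ℝ) • (z + t)‖ ≤ 3 / 4 := by
    rw [norm_smul]
    have := norm_add_le z t
    norm_num
    linarith
  have hplus := hbound ((3 : ℝ) • (z - t) + (1 / 3 : ℝ) • (z + t))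
  have hminus := hbound ((3 : ℝ) • (z - t) - (1 / 3 : ℝ) • (z + t))
  have hu2 := mul_self_le_mul_self (norm_nonneg _) hu
  have hv2 := mul_self_le_mul_self (norm_nonneg _) hv
  have hdiff : 4 * |Q z - Q t| ≤ |Q z| * (9 / 4) := by
    rw [show 4 * |Q z - Q t| = |4 * (Q z - Q t)| by rw [abs_mul]; norm_num, hpol]
    refine (abs_sub _ _).trans ((add_le_add hplus hminus).trans ?_)
    rw [← mul_add]
    refine mul_le_mul_of_nonneg_left ?_ (abs_nonneg _)
    nlinarith
  have htri : |Q z| ≤ |Q t| + |Q z - Q t| := by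
    have := abs_add_le (Q t) (Q z - Q t)
    rwa [add_sub_cancel] at this
  have htpos : 0 < ‖t‖ := by
    have := norm_sub_norm_le z t
    rw [hz1] at this
    linarith
  have hs0 : 0 ≤ s := by
    have := (abs_nonneg _).trans (hs t ht)
    exact nonneg_of_mul_nonneg_left this (by positivity)
  have hst : s * ‖t‖ ^ 2 ≤ s * (25 / 16) :=
    mul_le_mul_of_nonneg_left (by nlinarith) hs0
  have hK : |Q z| ≤ 4 * s := by
    have := hs t ht
    linarith
  exact (hbound x).trans (mul_le_mul_of_nonneg_right hK (sq_nonneg _))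

/-! ### Concentration of the sampled quadratic form -/

/-- The quadratic form `x ↦ ∑ₖ cₖ ⟪x, ψₖ⟫² - ‖x‖²`. -/
noncomputable def frameDefect {N m : ℕ} (c : Fin N → ℝ) (ψ : Fin N → EuclideanSpace ℝ (Fin m)) :
    QuadraticForm ℝ (EuclideanSpace ℝ (Fin m)) :=
  ∑ k, c k • QuadraticMap.sq.comp (innerₗ (EuclideanSpace ℝ (Fin m)) (ψ k)) -
    LinearMap.BilinMap.toQuadraticMap (innerₗ (EuclideanSpace ℝ (Fin m)))

theorem frameDefect_apply {N m : ℕ} (c : Fin N → ℝ) (ψ : Fin N → EuclideanSpace ℝ (Fin m))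
    (x : EuclideanSpace ℝ (Fin m)) :
    frameDefect c ψ x = ∑ k, c k * (inner ℝ x (ψ k)) ^ 2 - ‖x‖ ^ 2 := by
  simp [frameDefect, sum_apply, real_inner_comm, sq]

theorem continuous_frameDefect {N m : ℕ} (c : Fin N → ℝ)
    (ψ : Fin N → EuclideanSpace ℝ (Fin m)) : Continuous (frameDefect c ψ) := by
  rw [show ⇑(frameDefect c ψ) = fun x => ∑ k, c k * (inner ℝ x (ψ k)) ^ 2 - ‖x‖ ^ 2 from
    funext (frameDefect_apply c ψ)]
  fun_prop

section Sampling

variable {n m : ℕ} {w : Fin n → ℝ} {φ : Fin n → EuclideanSpace ℝ (Fin m)}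

/-- The sampled form at a fixed vector: importance sampling makes each summand
`m ⟪t, φ i⟫² / ‖φ i‖²` bounded by `m ‖t‖²`, `m` times its mean. -/
theorem pi_real_frame_error_le (hw : ∀ i, 0 < w i) (hm : 0 < m) (hne : ∀ i, φ i ≠ 0)
    (hφ : ∀ a, ∑ i, w i * (inner ℝ a (φ i)) ^ 2 = ‖a‖ ^ 2) {N : ℕ} (hN : 0 < N)
    {s : ℝ} (hs : 0 < s) (hs1 : s ≤ 1) (t : EuclideanSpace ℝ (Fin m)) :
    (Measure.pi fun _ : Fin N =>
      ∑ i, ENNReal.ofReal (w i * ‖φ i‖ ^ 2 / m) • Measure.dirac i : Measure (Fin N → Fin n)).real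
      {x | s * ‖t‖ ^ 2 < |frameDefect (fun k => m / (N * ‖φ (x k)‖ ^ 2)) (φ ∘ x) t|} ≤
      2 * Real.exp (-(N * (s ^ 2 / (4 * m)))) := by
  rcases eq_or_ne t 0 with rfl | ht
  · simp only [QuadraticMap.map_zero, norm_zero, abs_zero]
    norm_num
    positivity
  have hm' : (0 : ℝ) < m := by exact_mod_cast hm
  have hN' : (0 : ℝ) < N := by exact_mod_cast hN
  have ht' : 0 < ‖t‖ := norm_pos_iff.2 ht
  have hφpos : ∀ i, 0 < ‖φ i‖ := fun i => norm_pos_iff.2 (hne i)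
  have hp : ∀ i, 0 ≤ w i * ‖φ i‖ ^ 2 / m := fun i => by have := hw i; positivity
  have hP := isProbabilityMeasure_sum_dirac hp (by
    rw [← Finset.sum_div, sum_mul_norm_sq_of_isotropic hφ, div_self hm'.ne'])
  have hmean : ∫ i, m * (inner ℝ t (φ i)) ^ 2 / ‖φ i‖ ^ 2
      ∂(∑ i, ENNReal.ofReal (w i * ‖φ i‖ ^ 2 / m) • Measure.dirac i) = ‖t‖ ^ 2 := by
    rw [integral_sum_dirac hp, ← hφ]
    refine Finset.sum_congr rfl fun i _ => ?_
    have := (hφpos i).ne'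
    field_simp
  have hmain := pi_real_abs_sum_sub_le (N := N) (b := m * ‖t‖ ^ 2) (s := s)
    (X := fun i => m * (inner ℝ t (φ i)) ^ 2 / ‖φ i‖ ^ 2) (fun i => by positivity)
    (fun i => ?_) hmean (by positivity) hs hs1
  · rw [show s ^ 2 * ‖t‖ ^ 2 / (4 * (m * ‖t‖ ^ 2)) = s ^ 2 / (4 * m) by field_simp] at hmain
    refine le_trans (measureReal_mono ?_) hmain
    intro x hx
    simp only [Set.mem_ofPred_eq] at hx ⊢
    have e : ∑ k, m * (inner ℝ t (φ (x k))) ^ 2 / ‖φ (x k)‖ ^ 2 - N * ‖t‖ ^ 2 =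
        N * frameDefect (fun k => m / (N * ‖φ (x k)‖ ^ 2)) (φ ∘ x) t := by
      rw [frameDefect_apply, mul_sub, Finset.mul_sum]
      congr 1
      refine Finset.sum_congr rfl fun k _ => ?_
      have := (hφpos (x k)).ne'
      simp only [Function.comp_apply]
      field_simp
    rw [e, abs_mul, abs_of_pos hN']
    exact mul_lt_mul_of_pos_left hx hN'
  · rw [div_le_iff₀ (pow_pos (hφpos i) 2), mul_assoc, ← mul_pow ‖t‖]
    refine mul_le_mul_of_nonneg_left ?_ hm'.le
    rw [← sq_abs]
    exact pow_le_pow_left₀ (abs_nonneg _) (abs_real_inner_le_norm _ _) 2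

/-- Union bound over the grid, with relative error `ε / 4` at each of its points. -/
theorem le_pi_real_frameDefect (hw : ∀ i, 0 < w i) (hm : 0 < m) (hne : ∀ i, φ i ≠ 0)
    (hφ : ∀ a, ∑ i, w i * (inner ℝ a (φ i)) ^ 2 = ‖a‖ ^ 2) {N : ℕ} (hN : 0 < N)
    {ε : ℝ} (hε : 0 < ε) (hε1 : ε < 1) :
    1 - (8 * m + 1) ^ m * (2 * Real.exp (-(N * (ε ^ 2 / (64 * m))))) ≤
    (Measure.pi fun _ : Fin N =>
      ∑ i, ENNReal.ofReal (w i * ‖φ i‖ ^ 2 / m) • Measure.dirac i : Measure (Fin N → Fin n)).real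
      {x | ∀ a, |frameDefect (fun k => m / (N * ‖φ (x k)‖ ^ 2)) (φ ∘ x) a| ≤ ε * ‖a‖ ^ 2} := by
  have hm' : (0 : ℝ) < m := by exact_mod_cast hm
  have hp : ∀ i, 0 ≤ w i * ‖φ i‖ ^ 2 / m := fun i => by have := hw i; positivity
  have hP := isProbabilityMeasure_sum_dirac hp (by
    rw [← Finset.sum_div, sum_mul_norm_sq_of_isotropic hφ, div_self hm'.ne'])
  set M : Measure (Fin N → Fin n) := Measure.pi fun _ : Fin N =>
      ∑ i, ENNReal.ofReal (w i * ‖φ i‖ ^ 2 / m) • Measure.dirac i with hM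
  have : IsProbabilityMeasure M := by rw [hM]; infer_instance
  have hbad : M.real (⋃ t ∈ cubeGrid m, {x | ε / 4 * ‖t‖ ^ 2 <
      |frameDefect (fun k => m / (N * ‖φ (x k)‖ ^ 2)) (φ ∘ x) t|}) ≤
      (8 * m + 1) ^ m * (2 * Real.exp (-(N * (ε ^ 2 / (64 * m))))) := by
    refine (measureReal_biUnion_finset_le _ _).trans ?_
    refine (Finset.sum_le_card_nsmul _ _ _ fun t _ =>
      pi_real_frame_error_le hw hm hne hφ hN (by positivity : 0 < ε / 4) (by linarith) t).trans ?_
    rw [nsmul_eq_mul, show (ε / 4) ^ 2 / (4 * m) = ε ^ 2 / (64 * m) by field_simp; norm_num]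
    refine mul_le_mul_of_nonneg_right ?_ (by positivity)
    exact_mod_cast card_cubeGrid_le m
  rw [sub_le_comm, ← probReal_compl_eq_one_sub (Set.toFinite _).measurableSet]
  refine le_trans (measureReal_mono ?_ (measure_ne_top _ _)) hbad
  rw [Set.compl_subset_comm]
  intro x hx a
  have := abs_quadraticForm_le_of_cubeGrid hm
    (continuous_frameDefect (fun k => m / (N * ‖φ (x k)‖ ^ 2)) (φ ∘ x)) (s := ε / 4)
    (fun t ht => by
      by_contra hcon
      exact hx (Set.mem_biUnion ht (not_le.1 hcon))) a
  rwa [mul_div_cancel₀ _ (by norm_num : (4 : ℝ) ≠ 0)] at this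

end Sampling

/-! ### The sample size -/

/-- The constant is `1664 = 13 * 128`: the union bound costs `13 d log (max d 2)` in the exponent,
and `64 m ≤ 128 d`. -/
theorem grid_union_bound_le {d m N : ℕ} {ε δ : ℝ} (hd : 1 ≤ d) (hm : 0 < m) (hmd : m ≤ d + 1)
    (hε : 0 < ε) (hδ : 0 < δ) (hδ1 : δ < 1)
    (hN : 1664 * (d / ε ^ 2 * (d * Real.log (max (d : ℝ) 2) + Real.log (1 / δ))) ≤ N) :
    (8 * m + 1 : ℝ) ^ m * (2 * Real.exp (-(N * (ε ^ 2 / (64 * m))))) ≤ δ := by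
  have hd' : (1 : ℝ) ≤ d := by exact_mod_cast hd
  have hm' : (0 : ℝ) < m := by exact_mod_cast hm
  have hmd' : (m : ℝ) ≤ 2 * d := by
    have : (m : ℝ) ≤ d + 1 := by exact_mod_cast hmd
    linarith
  set D : ℝ := max (d : ℝ) 2 with hD
  have hdD : (d : ℝ) ≤ D := le_max_left _ _
  have hD2 : (2 : ℝ) ≤ D := le_max_right _ _
  have hL2 : Real.log 2 ≤ Real.log D := Real.log_le_log (by norm_num) hD2
  have hL : 0 < Real.log D := Real.log_pos (by linarith)
  have hδL : 0 < Real.log (1 / δ) := Real.log_pos (by rw [lt_div_iff₀ hδ]; linarith)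
  have hlog : Real.log (8 * m + 1) ≤ 6 * Real.log D := by
    -- `8 m + 1 ≤ 16 d + 1 ≤ 2 ^ 5 * max d 2`, and `2 ≤ max d 2`
    have h5 : (2 : ℝ) ^ 5 ≤ D ^ 5 := pow_le_pow_left₀ (by norm_num) hD2 5
    have : (8 * m + 1 : ℝ) ≤ D ^ 6 := by
      calc (8 * m + 1 : ℝ) ≤ 2 ^ 5 * D := by linarith
        _ ≤ D ^ 5 * D := mul_le_mul_of_nonneg_right h5 (by linarith)
        _ = D ^ 6 := by ring
    calc Real.log (8 * m + 1) ≤ Real.log (D ^ 6) := Real.log_le_log (by positivity) this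
      _ = 6 * Real.log D := by rw [Real.log_pow]; norm_num
  have hexp : 13 * (d * Real.log D + Real.log (1 / δ)) ≤ N * (ε ^ 2 / (64 * m)) := by
    have h1 : 1664 * (d * (d * Real.log D + Real.log (1 / δ))) ≤ N * ε ^ 2 := by
      have := mul_le_mul_of_nonneg_right hN (sq_nonneg ε)
      refine le_trans (le_of_eq ?_) this
      field_simp
    rw [← mul_div_assoc, le_div_iff₀ (by positivity)]
    have h2 : 0 ≤ d * Real.log D + Real.log (1 / δ) := by positivity
    nlinarith [mul_le_mul_of_nonneg_left hmd' h2]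
  have hmlog : m * Real.log (8 * m + 1) ≤ 12 * (d * Real.log D) := by
    calc m * Real.log (8 * m + 1) ≤ 2 * d * (6 * Real.log D) :=
          mul_le_mul hmd' hlog (Real.log_nonneg (by linarith)) (by positivity)
      _ = _ := by ring
  have hdL : Real.log D ≤ d * Real.log D := le_mul_of_one_le_left hL.le hd'
  rw [← Real.log_le_log_iff (by positivity) hδ, Real.log_mul (by positivity) (by positivity),
    Real.log_mul (by norm_num) (by positivity), Real.log_exp, Real.log_pow]
  rw [one_div, Real.log_inv] at hexp hδL
  linarith

/-! ### Distances of hyperplanes -/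

theorem sketchDist_sq {d n : ℕ} {w : Fin n → ℝ} (hw : ∀ i, 0 ≤ w i)
    (q : Fin n → EuclideanSpace ℝ (Fin d)) (h₁ h₂ : Hyperplane d) :
    sketchDist w q h₁ h₂ ^ 2 =
      ∑ i, w i * (h₁.signedDist (q i) - h₂.signedDist (q i)) ^ 2 := by
  rw [sketchDist, EuclideanSpace.norm_sq_eq]
  refine Finset.sum_congr rfl fun i _ => ?_
  simp only [sketch, PiLp.sub_apply, Real.norm_eq_abs, sq_abs]
  rw [← mul_sub, mul_pow, Real.sq_sqrt (hw i)]

theorem signedDist_sub_sq_mem_squaredAffine {d n : ℕ} (q : Fin n → EuclideanSpace ℝ (Fin d))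
    (h₁ h₂ : Hyperplane d) :
    (fun i => (h₁.signedDist (q i) - h₂.signedDist (q i)) ^ 2) ∈ squaredAffine q := by
  refine ⟨_, ⟨h₁.normal - h₂.normal, h₁.offset - h₂.offset, fun i => rfl⟩, fun i => ?_⟩
  simp only [Hyperplane.signedDist, PiLp.sub_apply, sub_mul, Finset.sum_sub_distrib]
  ring

theorem mul_le_and_le_mul_of_sq {x y ε : ℝ} (hx : 0 ≤ x) (hy : 0 ≤ y) (hε : 0 < ε) (hε1 : ε < 1)
    (h : (1 - ε) * x ^ 2 ≤ y ^ 2 ∧ y ^ 2 ≤ (1 + ε) * x ^ 2) :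
    (1 - ε) * x ≤ y ∧ y ≤ (1 + ε) * x := by
  have hx2 := sq_nonneg x
  constructor
  · refine (sq_le_sq₀ (mul_nonneg (by linarith) hx) hy).1 ?_
    rw [mul_pow]
    refine le_trans (mul_le_mul_of_nonneg_right ?_ hx2) h.1
    nlinarith
  · refine (sq_le_sq₀ hy (by positivity)).1 ?_
    rw [mul_pow]
    refine h.2.trans (mul_le_mul_of_nonneg_right ?_ hx2)
    nlinarith

theorem mainTheorem1 :
    ∃ C : ℝ, 0 < C ∧
      ∀ (d n : ℕ) (q : Fin n → EuclideanSpace ℝ (Fin d)) (w : Fin n → ℝ) (ε δ : ℝ) (N : ℕ),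
        1 ≤ d → FullRank q → (∀ i, 0 < w i) → ∑ i, w i = 1 →
        0 < ε → ε < 1 → 0 < δ → δ < 1 →
        C * (d / ε ^ 2 * (d * Real.log (max (d : ℝ) 2) + Real.log (1 / δ))) ≤ N →
        1 - δ ≤ (sensitivitySampling w (squaredAffine q) N).real
          {x : Fin N → Fin n |
            (∀ f ∈ squaredAffine q,
              (1 - ε) * weightedMean w f ≤
                  ∑ k, sampleWeight w (squaredAffine q) x k * f (x k) ∧
                ∑ k, sampleWeight w (squaredAffine q) x k * f (x k) ≤
                  (1 + ε) * weightedMean w f) ∧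
            ∀ h₁ h₂ : Hyperplane d,
              (1 - ε) * sketchDist w q h₁ h₂ ≤
                  sketchDist (sampleWeight w (squaredAffine q) x) (q ∘ x) h₁ h₂ ∧
                sketchDist (sampleWeight w (squaredAffine q) x) (q ∘ x) h₁ h₂ ≤
                  (1 + ε) * sketchDist w q h₁ h₂} := by
  refine ⟨1664, by norm_num, ?_⟩
  intro d n q w ε δ N hd _ hw hw1 hε hε1 hδ hδ1 hN
  obtain ⟨m, φ, hmd, hφ, hF⟩ := exists_isotropic q hw
  -- the constant function `1` lies in `F`, so no `φ i` vanishes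
  have hne : ∀ i, φ i ≠ 0 := fun i h0 => by
    have h1 : (fun _ => 1 : Fin n → ℝ) ∈ squaredAffine q :=
      ⟨fun _ => 1, ⟨0, 1, fun i => by simp⟩, fun i => by simp⟩
    rw [hF] at h1
    obtain ⟨a, ha⟩ := h1
    simpa [h0] using congrFun ha i
  have hm : 0 < m := by
    rcases Nat.eq_zero_or_pos m with rfl | h
    · have : IsEmpty (Fin n) := ⟨fun i => hne i (Subsingleton.elim _ _)⟩
      simp at hw1
    · exact h
  have hNpos : 0 < N := by
    have h1 : 0 < Real.log (1 / δ) := Real.log_pos (by rw [lt_div_iff₀ hδ]; linarith)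
    have h2 : 0 < Real.log (max (d : ℝ) 2) :=
      Real.log_pos (lt_of_lt_of_le one_lt_two (le_max_right _ _))
    have h3 : (0 : ℝ) < d := by exact_mod_cast hd
    have : (0 : ℝ) < N := lt_of_lt_of_le (by positivity) hN
    exact_mod_cast this
  have hbound := le_pi_real_frameDefect hw hm hne hφ hNpos hε hε1
  have hunion := grid_union_bound_le hd hm hmd hε hδ hδ1 hN
  have hσ : ∀ i, sensitivity w (squaredAffine q) i = ‖φ i‖ ^ 2 := fun i => by
    rw [hF, sensitivity_of_isotropic hφ]
  have hS : totalSensitivity w (squaredAffine q) = m := by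
    rw [hF, totalSensitivity_of_isotropic hφ]
  have hlaw : sensitivitySampling w (squaredAffine q) N = Measure.pi fun _ : Fin N =>
      ∑ i, ENNReal.ofReal (w i * ‖φ i‖ ^ 2 / m) • Measure.dirac i := by
    simp only [sensitivitySampling, sensitivityLaw, hσ, hS]
  have hp : ∀ i, 0 ≤ w i * ‖φ i‖ ^ 2 / m := fun i => by have := hw i; positivity
  have hP := isProbabilityMeasure_sum_dirac hp (by
    rw [← Finset.sum_div, sum_mul_norm_sq_of_isotropic hφ, div_self (by positivity)])
  rw [hlaw]
  refine le_trans (by linarith) (hbound.trans (measureReal_mono ?_))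
  intro x hx
  have hcoreset : ∀ f ∈ squaredAffine q,
      (1 - ε) * weightedMean w f ≤ ∑ k, sampleWeight w (squaredAffine q) x k * f (x k) ∧
        ∑ k, sampleWeight w (squaredAffine q) x k * f (x k) ≤ (1 + ε) * weightedMean w f := by
    intro f hf
    rw [hF] at hf
    obtain ⟨a, rfl⟩ := hf
    have h := hx a
    rw [frameDefect_apply, abs_le] at h
    simp only [weightedMean, hφ, sampleWeight, hσ, hS]
    simp only [Function.comp_apply] at h
    constructor <;> linarith
  refine ⟨hcoreset, fun h₁ h₂ => mul_le_and_le_mul_of_sq (norm_nonneg _) (norm_nonneg _) hε hε1 ?_⟩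
  have hW : ∀ k, 0 ≤ sampleWeight w (squaredAffine q) x k := fun k => by
    simp only [sampleWeight, hσ, hS]
    positivity
  rw [sketchDist_sq (fun i => (hw i).le), sketchDist_sq hW]
  exact hcoreset _ (signedDist_sub_sq_mem_squaredAffine q h₁ h₂)
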